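/- Let $d\ge 1$ and let $G$ be the unweighted $d$-dimensional grid graph with $n_1,\dots,n_d$ layers: the Cartesian product of the paths $P_{n_1},\dots,P_{n_d}$, with nodes $\mathbf x=[x_1,\dots,x_d]$, $1\le x_j\le n_j$. Assume that $G$ has at least one inner node, i.e. a node with two neighbours in each dimension. Let $S$ be the adjacency matrix, $D$ the diagonal degree matrix, $L=D-S$, let $\mathbb L=LD^{-1}$ be the random walk Laplacian and $\mathfrak L=D^{-1/2}LD^{-1/2}$ the normalized Laplacian. For an integer vector $\mathbf z=[z_1,\dots,z_d]$ and real unknowns $\lambda,\delta_1,\dots,\delta_d$ with $\cos\delta_l\neq 0$ for all $l$, consider the system of $d+1$ equations $$2d\,\lambda=\sum_{j=1}^d\Bigl(2+2\cos\tfrac{z_j\pi-2\delta_j}{n_j-1}\Bigr),\qquad \lambda=1+\cos\tfrac{z_l\pi-2\delta_l}{n_l-1}+\tan(\delta_l)\,\sin\tfrac{z_l\pi-2\delta_l}{n_l-1}\quad(l=1,\dots,d).\tag{$*$}$$ 1. For every integer vector $\mathbf z$ and every solution $(\lambda,\boldsymbol\delta)$ of $(*)$, $$\lambda=1+\frac1d\sum_{j=1}^d\cos\Bigl(\frac{1}{n_j-1}(z_j\pi-2\delta_j)\Bigr),$$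 and $\lambda$ is an eigenvalue of $\mathbb L$ with (nonzero) eigenvector $$\nu_{\mathbf x}=D_{\mathbf x,\mathbf x}\prod_{j=1}^d(-1)^{x_j}\cos\Bigl(\frac{x_j-1}{n_j-1}(z_j\pi-2\delta_j)+\delta_j\Bigr).$$ Moreover $\lambda$ is an eigenvalue of $\mathfrak L$, with eigenvector given by the same formula with $D^{1/2}_{\mathbf x,\mathbf x}$ in place of $D_{\mathbf x,\mathbf x}$; the eigenvector of $\mathbb L$ is $D^{1/2}$ times that of $\mathfrak L$. 2. For every $\mathbf z$ with $0\le z_j\le n_j-1$ for all $j$, the system $(*)$ has a solution with $-\pi/2<\delta_j<\pi/2$ for all $j$. 3. If for each $\mathbf z$ with $0\le z_j\le n_j-1$ one chooses any solution $(\lambda_{\mathbf z},\boldsymbol\delta^{\mathbf z})$ of $(*)$ with all $|\delta^{\mathbf z}_j|<\pi/2$, then $\mathbb L$ and $\mathfrak L$ both have characteristic polynomial $\prod_{\mathbf z}(X-\lambda_{\mathbf z})$; in particular the eigenvalues of $\mathbb L$ are exactly the numbers $\lambda_{\mathbf z}$. The corresponding eigenvectors of $\mathbb L$, one for each $\mathbf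 z$, form a basis of $\mathbb R^{n_1\cdots n_d}$. -/

import Mathlib

open scoped Matrix

noncomputable section

/-- Nodes of the `d`-dimensional grid with `n j` layers in dimension `j`. Coordinates are stored
zero-based; `gridCoord` is the usual one-based coordinate `1 ≤ x_j ≤ n_j`. -/
abbrev GridNode {d : ℕ} (n : Fin d → ℕ) : Type := (j : Fin d) → Fin (n j)

/-- The one-based coordinate `x_j ∈ {1, …, n_j}` of a node. -/
def gridCoord {d : ℕ} {n : Fin d → ℕ} (x : GridNode n) (j : Fin d) : ℕ := (x j : ℕ) + 1

/-- The unweighted grid graph: the Cartesian (box) product of the path graphs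
`P_{n_1}, …, P_{n_d}`. -/
def gridGraph {d : ℕ} (n : Fin d → ℕ) : SimpleGraph (GridNode n) where
  Adj x y := ∃ j, (SimpleGraph.pathGraph (n j)).Adj (x j) (y j) ∧ ∀ i, i ≠ j → x i = y i
  symm := ⟨by
    rintro x y ⟨j, hj, h⟩
    exact ⟨j, hj.symm, fun i hi => (h i hi).symm⟩⟩
  loopless := ⟨by
    rintro x ⟨j, hj, -⟩
    exact hj.ne rfl⟩

instance gridGraphDecidableAdj {d : ℕ} (n : Fin d → ℕ) : DecidableRel (gridGraph n).Adj :=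
  Classical.decRel _

/-- A node is inner if it has two distinct neighbours along every dimension. -/
def IsInnerNode {d : ℕ} {n : Fin d → ℕ} (x : GridNode n) : Prop :=
  ∀ j, ∃ y y' : GridNode n, y ≠ y' ∧ (gridGraph n).Adj x y ∧ (gridGraph n).Adj x y' ∧
    ∀ i, i ≠ j → x i = y i ∧ x i = y' i

/-- The diagonal matrix `D` of node degrees. -/
abbrev gridD {d : ℕ} (n : Fin d → ℕ) : Matrix (GridNode n) (GridNode n) ℝ :=
  (gridGraph n).degMatrix ℝ

/-- `D^{1/2}`. -/
def gridDSqrt {d : ℕ} (n : Fin d → ℕ) : Matrix (GridNode n) (GridNode n) ℝ :=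
  Matrix.diagonal fun x => √((gridGraph n).degree x : ℝ)

/-- The combinatorial Laplacian `L = D - S`. -/
abbrev gridL {d : ℕ} (n : Fin d → ℕ) : Matrix (GridNode n) (GridNode n) ℝ :=
  (gridGraph n).lapMatrix ℝ

/-- The normalized Laplacian `D^{-1/2} L D^{-1/2}`. -/
def gridNormalizedLaplacian {d : ℕ} (n : Fin d → ℕ) : Matrix (GridNode n) (GridNode n) ℝ :=
  (gridDSqrt n)⁻¹ * gridL n * (gridDSqrt n)⁻¹

/-- The random walk Laplacian `L D^{-1}`. -/
def gridRandomWalkLaplacian {d : ℕ} (n : Fin d → ℕ) : Matrix (GridNode n) (GridNode n) ℝ :=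
  gridL n * (gridD n)⁻¹

/-- The angle `(z_j π - 2 δ_j) / (n_j - 1)`. -/
def gridAngle {d : ℕ} (n : Fin d → ℕ) (z : Fin d → ℤ) (δ : Fin d → ℝ) (j : Fin d) : ℝ :=
  1 / ((n j : ℝ) - 1) * ((z j : ℝ) * Real.pi - 2 * δ j)

/-- The system of `d + 1` equations for the eigenvalue and the shifts `δ_1, …, δ_d`. The clause
`cos δ_l ≠ 0` says that `tan δ_l` is defined. -/
structure IsShiftSolution {d : ℕ} (n : Fin d → ℕ) (z : Fin d → ℤ) (lam : ℝ) (δ : Fin d → ℝ) :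
    Prop where
  inner_eq : 2 * (d : ℝ) * lam = ∑ j, (2 + 2 * Real.cos (gridAngle n z δ j))
  tan_defined : ∀ l, Real.cos (δ l) ≠ 0
  border_eq : ∀ l, lam = 1 + Real.cos (gridAngle n z δ l) +
    Real.tan (δ l) * Real.sin (gridAngle n z δ l)

/-- The product `∏_j (-1)^{x_j} cos ((x_j - 1)/(n_j - 1) (z_j π - 2 δ_j) + δ_j)`. -/
def gridProduct {d : ℕ} (n : Fin d → ℕ) (z : Fin d → ℤ) (δ : Fin d → ℝ) (x : GridNode n) : ℝ :=
  ∏ j, (-1 : ℝ) ^ gridCoord x j *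
    Real.cos (((gridCoord x j : ℝ) - 1) / ((n j : ℝ) - 1) * ((z j : ℝ) * Real.pi - 2 * δ j) + δ j)

/-- The vector with components `D^{1/2}_{x,x} ∏_j …`, for the normalized Laplacian. -/
def normalizedVec {d : ℕ} (n : Fin d → ℕ) (z : Fin d → ℤ) (δ : Fin d → ℝ) : GridNode n → ℝ :=
  fun x => gridDSqrt n x x * gridProduct n z δ x

/-- The vector with components `D_{x,x} ∏_j …`, for the random walk Laplacian. -/
def randomWalkVec {d : ℕ} (n : Fin d → ℕ) (z : Fin d → ℤ) (δ : Fin d → ℝ) : GridNode n → ℝ :=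
  fun x => gridD n x x * gridProduct n z δ x

/-- A grid index seen as an integer vector `z` with `0 ≤ z_j ≤ n_j - 1`. -/
def gridIndex {d : ℕ} {n : Fin d → ℕ} (z : GridNode n) : Fin d → ℤ := fun j => ((z j : ℕ) : ℤ)

end

/-!
A product `∏_j φ_j(x_j)` of waves `φ_j(k) = (-1)^(k+1) cos (k θ_j + δ_j)` turns the eigenvalue problem
`L g = λ D g` on the grid into one problem per dimension. Put `μ = λ - 1`. Summing `g` over the
neighbours of a node splits into sums over the neighbours on each path. On the `j`-th path the wave
satisfies the three-term recurrence with factor `-2 cos θ_j`, and the border equation for `δ_j` says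
precisely that at the two end nodes, where a neighbour is missing, the factor becomes
`-2 cos θ_j + μ`. Hence the sum over all neighbours is `(-2 ∑ cos θ_j + μ (2 d - deg x)) g(x)`, which
is `-μ deg(x) g(x)` by the averaged equation (`sum_pathNbrs_pathMode`, `sum_neighborFinset_prod`).

Existence. For `0 ≤ z ≤ n - 1` the function `δ ↦ cos θ + tan δ sin θ` increases strictly from `-1` to
`1` on the interval `[-(n - 1 - z) π / (2 n), z π / (2 n)]`, because there `θ` and `θ - δ` lie in
`[0, π]` (`strictMonoOn_borderValue`). Each `δ_j` is therefore a continuous function of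
`μ ∈ [-1, 1]`, and the averaged equation `d μ = ∑ cos θ_j(μ)` is solved by the intermediate value
theorem (`exists_common_shift`).

Completeness. Eigenvectors for different `λ` are independent. For a common `λ` and different
indices `z_j ≠ z'_j`, the two waves in dimension `j` are eigenvectors of one symmetric matrix, the
adjacency matrix of the path perturbed by `μ` at its ends, with eigenvalues `-2 cos θ` and
`-2 cos θ'`. These are different: `cos θ = cos θ'` would force `2 (δ' ∓ δ)` to be a multiple of `π`,
which is either `0`, giving `z_j = z'_j`, or `±π`, contradicting the equality of the border terms
`tan δ sin θ = tan δ' sin θ'`, or, if `sin θ = 0`, the fact that both shifts then vanish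
(`cos_ne_cos_of_index_ne`). So the product waves are orthogonal, the
vectors form a basis, and both characteristic polynomials are read off from it, the two Laplacians
being similar (`gridRandomWalkLaplacian_eq_conj`).
-/

open Finset

/-! ### Standing waves on a path -/

/-- The standing wave `k ↦ (-1)^(k+1) cos (k θ + δ)` with zero-based position `k`. -/
noncomputable def pathMode (θ δ : ℝ) (k : ℕ) : ℝ := (-1) ^ (k + 1) * Real.cos (k * θ + δ)

/-- The positions adjacent to `i` on the path with `m` nodes. -/
def pathNbrs {m : ℕ} (i : Fin m) : Finset (Fin m) :=
  univ.filter fun k => (i : ℕ) + 1 = k ∨ (k : ℕ) + 1 = i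

theorem mem_pathNbrs {m : ℕ} {i k : Fin m} :
    k ∈ pathNbrs i ↔ (SimpleGraph.pathGraph m).Adj i k := by
  simp [pathNbrs, SimpleGraph.pathGraph_adj]

theorem sum_pathNbrs {m : ℕ} (f : ℕ → ℝ) (i : Fin m) :
    ∑ k ∈ pathNbrs i, f k =
      (if (i : ℕ) + 1 < m then f (i + 1) else 0) + (if 0 < (i : ℕ) then f (i - 1) else 0) := by
  have h : ∀ k : Fin m, (if (i : ℕ) + 1 = k ∨ (k : ℕ) + 1 = i then f k else 0) =
      (fun k : ℕ => (if (i : ℕ) + 1 = k then f k else 0) +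
        (if 0 < (i : ℕ) then (if (i : ℕ) - 1 = k then f k else 0) else 0)) k := by
    intro k
    by_cases h1 : (i : ℕ) + 1 = k
    · rw [if_pos (Or.inl h1)]
      have : ¬ ((i : ℕ) - 1 = k) := by omega
      simp [h1, this]
    · by_cases h2 : (k : ℕ) + 1 = i
      · rw [if_pos (Or.inr h2)]
        have h3 : (i : ℕ) - 1 = k := by omega
        have h4 : 0 < (i : ℕ) := by omega
        simp [h1, h3, h4]
      · rw [if_neg (by tauto)]
        by_cases h4 : 0 < (i : ℕ)
        · have : ¬ ((i : ℕ) - 1 = k) := by omega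
          simp [h1, this]
        · simp [h1, h4]
  have hi := i.2
  rw [pathNbrs, sum_filter, sum_congr rfl fun k _ => h k,
    Fin.sum_univ_eq_sum_range (fun k : ℕ => (if (i : ℕ) + 1 = k then f k else 0) +
        (if 0 < (i : ℕ) then (if (i : ℕ) - 1 = k then f k else 0) else 0)) m,
    sum_add_distrib, sum_ite_eq]
  simp only [mem_range]
  congr 1
  split_ifs with h4
  · rw [sum_ite_eq, if_pos (by simp; omega)]
  · simp

theorem card_pathNbrs {m : ℕ} (i : Fin m) :
    ((pathNbrs i).card : ℝ) =
      (if (i : ℕ) + 1 < m then 1 else 0) + (if 0 < (i : ℕ) then 1 else 0) := by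
  simpa using sum_pathNbrs (fun _ => 1) i

theorem pathMode_recurrence (θ δ : ℝ) (k : ℕ) :
    pathMode θ δ (k + 2) + pathMode θ δ k = -2 * Real.cos θ * pathMode θ δ (k + 1) := by
  simp only [pathMode]
  have e1 : ((k + 2 : ℕ) : ℝ) * θ + δ = (((k + 1 : ℕ) : ℝ) * θ + δ) + θ := by push_cast; ring
  have e2 : (k : ℝ) * θ + δ = (((k + 1 : ℕ) : ℝ) * θ + δ) - θ := by push_cast; ring
  rw [e1, e2, Real.cos_add, Real.cos_sub]
  ring

/-- On a path of `m + 2` nodes, the wave solves the eigenvalue equation of the adjacency matrix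
perturbed by `μ` at each of the two end nodes: `2 - degree` counts the neighbours missing there. -/
theorem sum_pathNbrs_pathMode {m : ℕ} {θ δ μ : ℝ} {z : ℤ}
    (hθ : ((m : ℝ) + 1) * θ = z * Real.pi - 2 * δ)
    (hμ : μ * Real.cos δ = Real.cos (θ - δ)) (i : Fin (m + 2)) :
    ∑ k ∈ pathNbrs i, pathMode θ δ k =
      (-2 * Real.cos θ + μ * (2 - ((pathNbrs i).card : ℝ))) * pathMode θ δ i := by
  rw [sum_pathNbrs, card_pathNbrs]
  obtain ⟨i, hi⟩ := i
  simp only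
  rw [Real.cos_sub] at hμ
  rcases Nat.eq_zero_or_pos i with rfl | h0
  · simp only [pathMode]
    simp [Real.cos_add]
    linear_combination hμ
  · obtain ⟨k, rfl⟩ : ∃ k, i = k + 1 := ⟨i - 1, by omega⟩
    by_cases h1 : k + 1 + 1 < m + 2
    · simp only [h1, h0, if_true]
      have := pathMode_recurrence θ δ k
      rw [show k + 1 - 1 = k by omega]
      linear_combination this
    · obtain rfl : k = m := by omega
      have e1 : pathMode θ δ (k + 1) = (-1) ^ k * ((-1) ^ z * Real.cos δ) := by
        rw [pathMode, show ((k + 1 : ℕ) : ℝ) * θ + δ = z * Real.pi - δ by push_cast; linarith,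
          Real.cos_int_mul_pi_sub]
        ring
      have e2 : pathMode θ δ k = - (-1) ^ k * ((-1) ^ z * Real.cos (θ + δ)) := by
        rw [pathMode, show (k : ℝ) * θ + δ = z * Real.pi - (θ + δ) by linarith,
          Real.cos_int_mul_pi_sub]
        ring
      simp only [h1, h0, if_true, if_false, Nat.add_sub_cancel]
      rw [e1, e2, Real.cos_add]
      linear_combination (-(-1) ^ k * (-1) ^ z) * hμ

theorem sum_pathNbrs_comm {m : ℕ} (f g : Fin m → ℝ) :
    ∑ i, f i * ∑ k ∈ pathNbrs i, g k = ∑ i, g i * ∑ k ∈ pathNbrs i, f k := by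
  simp only [pathNbrs, sum_filter, mul_sum]
  rw [sum_comm]
  refine sum_congr rfl fun i _ => sum_congr rfl fun k _ => ?_
  have : ((k : ℕ) + 1 = i ∨ (i : ℕ) + 1 = k) ↔ ((i : ℕ) + 1 = k ∨ (k : ℕ) + 1 = i) := or_comm
  simp only [this]
  split_ifs <;> ring

/-- Two waves for the same perturbation `μ` are eigenvectors of one symmetric matrix, so they are
orthogonal as soon as their eigenvalues `-2 cos θ` differ. -/
theorem sum_pathMode_mul_eq_zero {m : ℕ} {θ δ θ' δ' μ : ℝ} {z z' : ℤ}
    (hθ : ((m : ℝ) + 1) * θ = z * Real.pi - 2 * δ)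
    (hθ' : ((m : ℝ) + 1) * θ' = z' * Real.pi - 2 * δ')
    (hμ : μ * Real.cos δ = Real.cos (θ - δ)) (hμ' : μ * Real.cos δ' = Real.cos (θ' - δ'))
    (hne : Real.cos θ ≠ Real.cos θ') :
    ∑ i : Fin (m + 2), pathMode θ δ i * pathMode θ' δ' i = 0 := by
  have h := sum_pathNbrs_comm (fun i : Fin (m + 2) => pathMode θ δ i)
    (fun i => pathMode θ' δ' i)
  simp only [sum_pathNbrs_pathMode hθ hμ, sum_pathNbrs_pathMode hθ' hμ'] at h
  rw [← sub_eq_zero, ← sum_sub_distrib] at h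
  have h2 : (2 * (Real.cos θ - Real.cos θ')) *
      ∑ i : Fin (m + 2), pathMode θ δ i * pathMode θ' δ' i = 0 := by
    rw [mul_sum, ← h]
    exact sum_congr rfl fun i _ => by ring
  rcases mul_eq_zero.1 h2 with h3 | h3
  · exact absurd (by linarith) hne
  · exact h3

/-! ### Distinct indices give distinct path eigenvalues -/

/-- If `2 a` is a multiple of `π` with `|a| < π`, then `a` is `0` or `±π/2`. -/
theorem shift_cases {a : ℝ} {m : ℤ} (h : 2 * a = m * Real.pi) (ha : |a| < Real.pi) :
    m = 0 ∨ Real.cos a = 0 := by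
  have hp := Real.pi_pos
  rw [abs_lt] at ha
  have h1 : m < 2 := by
    have : (m : ℝ) < 2 := by nlinarith
    exact_mod_cast this
  have h2 : -2 < m := by
    have : (-2 : ℝ) < m := by nlinarith
    exact_mod_cast this
  obtain rfl | rfl | rfl : m = 0 ∨ m = 1 ∨ m = -1 := by omega
  · exact Or.inl rfl
  · right
    rw [show a = Real.pi / 2 by push_cast at h; linarith, Real.cos_pi_div_two]
  · right
    rw [show a = -(Real.pi / 2) by push_cast at h; linarith, Real.cos_neg, Real.cos_pi_div_two]

theorem eq_zero_of_sin_eq_zero {m : ℕ} {θ δ : ℝ} {z : ℤ}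
    (hθ : ((m : ℝ) + 1) * θ = z * Real.pi - 2 * δ) (hδ : |δ| < Real.pi / 2)
    (hs : Real.sin θ = 0) : δ = 0 := by
  obtain ⟨k, hk⟩ := Real.sin_eq_zero_iff.1 hs
  have hp := Real.pi_pos
  have h : 2 * δ = ((z - (m + 1) * k : ℤ) : ℝ) * Real.pi := by
    push_cast; rw [← hk] at hθ; linarith
  generalize z - (m + 1) * k = w at h
  rw [abs_lt] at hδ
  have h1 : w < 1 := by
    have : (w : ℝ) < 1 := by nlinarith
    exact_mod_cast this
  have h2 : -1 < w := by
    have : (-1 : ℝ) < w := by nlinarith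
    exact_mod_cast this
  obtain rfl : w = 0 := by omega
  simpa using h

/-- The heart of the uniqueness argument: two waves whose angles agree modulo `2π` and whose border
equations have the same right-hand side have the same index, up to multiples of `2 (m + 1)`. -/
theorem index_sub_eq {m : ℕ} {θ δ θ' δ' : ℝ} {z z' k : ℤ}
    (hθ : ((m : ℝ) + 1) * θ = z * Real.pi - 2 * δ)
    (hθ' : ((m : ℝ) + 1) * θ' = z' * Real.pi - 2 * δ')
    (hδ : |δ| < Real.pi / 2) (hδ' : |δ'| < Real.pi / 2)
    (hk : θ' = 2 * k * Real.pi + θ)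
    (ht : Real.tan δ * Real.sin θ = Real.tan δ' * Real.sin θ') :
    z' - z = 2 * k * (m + 1) := by
  have hp := Real.pi_pos
  have hs : Real.sin θ' = Real.sin θ := by
    rw [hk, show 2 * (k : ℝ) * Real.pi + θ = θ + k * (2 * Real.pi) by ring,
      Real.sin_add_int_mul_two_pi]
  have h : 2 * (δ' - δ) = ((z' - z - 2 * k * (m + 1) : ℤ) : ℝ) * Real.pi := by
    push_cast; rw [hk] at hθ'; linarith
  have hc : 0 < Real.cos δ := Real.cos_pos_of_mem_Ioo ⟨by linarith [abs_lt.1 hδ], (abs_lt.1 hδ).2⟩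
  have hc' : 0 < Real.cos δ' :=
    Real.cos_pos_of_mem_Ioo ⟨by linarith [abs_lt.1 hδ'], (abs_lt.1 hδ').2⟩
  have hab : |δ' - δ| < Real.pi := by
    rw [abs_lt] at *; constructor <;> linarith
  rcases shift_cases h hab with h0 | h0
  · omega
  · exfalso
    rw [Real.cos_sub] at h0
    by_cases hsz : Real.sin θ = 0
    · rw [eq_zero_of_sin_eq_zero hθ hδ hsz, eq_zero_of_sin_eq_zero hθ' hδ' (hs.trans hsz)] at h0
      simp at h0
    · -- equal tangents give `sin δ' sin δ ≥ 0`, so `cos (δ' - δ)` cannot vanish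
      rw [hs] at ht
      have ht := mul_right_cancel₀ hsz ht
      rw [Real.tan_eq_sin_div_cos, Real.tan_eq_sin_div_cos, div_eq_div_iff hc.ne' hc'.ne'] at ht
      have : Real.cos δ * (Real.cos δ' * Real.cos δ + Real.sin δ' * Real.sin δ) =
          Real.cos δ' * (Real.cos δ ^ 2 + Real.sin δ ^ 2) := by
        linear_combination (-Real.sin δ) * ht
      rw [h0, Real.cos_sq_add_sin_sq] at this
      linarith

theorem cos_ne_cos_of_index_ne {m : ℕ} {θ δ θ' δ' μ : ℝ} {z z' : ℤ}
    (hθ : ((m : ℝ) + 1) * θ = z * Real.pi - 2 * δ)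
    (hθ' : ((m : ℝ) + 1) * θ' = z' * Real.pi - 2 * δ')
    (hδ : |δ| < Real.pi / 2) (hδ' : |δ'| < Real.pi / 2)
    (hμ : μ = Real.cos θ + Real.tan δ * Real.sin θ)
    (hμ' : μ = Real.cos θ' + Real.tan δ' * Real.sin θ')
    (hz : 0 ≤ z) (hz' : 0 ≤ z') (hzm : z ≤ m + 1) (hzm' : z' ≤ m + 1) (hne : z ≠ z') :
    Real.cos θ ≠ Real.cos θ' := by
  intro hcos
  have ht : Real.tan δ * Real.sin θ = Real.tan δ' * Real.sin θ' := by linarith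
  obtain ⟨k, hk | hk⟩ := Real.cos_eq_cos_iff.1 hcos
  · have := index_sub_eq hθ hθ' hδ hδ' hk ht
    rcases lt_trichotomy k 0 with h | rfl | h
    · nlinarith
    · simp at this; omega
    · nlinarith
  · -- `(-z, -θ, -δ)` describes the same wave as `(z, θ, δ)`
    have := index_sub_eq (θ := -θ) (δ := -δ) (z := -z) (k := k) (by push_cast; linarith) hθ'
      (by rwa [abs_neg]) hδ' (by rw [hk]; ring)
      (by rw [Real.tan_neg, Real.sin_neg, neg_mul_neg]; exact ht)
    rcases lt_trichotomy k 1 with h | rfl | h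
    · have : z' + z ≤ 0 := by nlinarith
      omega
    · omega
    · nlinarith

/-! ### Solving the border equation in one dimension -/

/-- The angle of the wave with index `z` and shift `δ` on a path of `m + 2` nodes. -/
noncomputable def pathAngle (m : ℕ) (z δ : ℝ) : ℝ := 1 / ((m : ℝ) + 1) * (z * Real.pi - 2 * δ)

/-- The value of `λ - 1` demanded by the border equation with shift `δ`. -/
noncomputable def borderValue (m : ℕ) (z δ : ℝ) : ℝ :=
  Real.cos (pathAngle m z δ) + Real.tan δ * Real.sin (pathAngle m z δ)

theorem mul_pathAngle (m : ℕ) (z δ : ℝ) :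
    ((m : ℝ) + 1) * pathAngle m z δ = z * Real.pi - 2 * δ := by
  rw [pathAngle]; field_simp

/-- The lower end of the shift interval: there the angle is `π + 2 δ`. -/
noncomputable def shiftMin (m : ℕ) (z : ℝ) : ℝ := -((m + 1 - z) * Real.pi / (2 * (m + 2)))

/-- The upper end of the shift interval: there the angle is `2 δ`. -/
noncomputable def shiftMax (m : ℕ) (z : ℝ) : ℝ := z * Real.pi / (2 * (m + 2))

section
variable {m : ℕ} {z δ : ℝ}

theorem mul_shiftMin (m : ℕ) (z : ℝ) :
    2 * ((m : ℝ) + 2) * shiftMin m z = -((m + 1 - z) * Real.pi) := by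
  rw [shiftMin]; field_simp

theorem mul_shiftMax (m : ℕ) (z : ℝ) : 2 * ((m : ℝ) + 2) * shiftMax m z = z * Real.pi := by
  rw [shiftMax]; field_simp

theorem shiftMin_le_shiftMax (m : ℕ) (z : ℝ) : shiftMin m z ≤ shiftMax m z := by
  have h1 := mul_shiftMin m z
  have h2 := mul_shiftMax m z
  have : (0 : ℝ) < 2 * ((m : ℝ) + 2) := by positivity
  refine le_of_mul_le_mul_left ?_ this
  have : 0 < ((m : ℝ) + 1) * Real.pi := by positivity
  linarith

theorem abs_lt_of_mem_shift (hz : 0 ≤ z) (hzm : z ≤ m + 1)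
    (hδ : δ ∈ Set.Icc (shiftMin m z) (shiftMax m z)) : |δ| < Real.pi / 2 := by
  have hp := Real.pi_pos
  have h1 := mul_shiftMin m z
  have h2 := mul_shiftMax m z
  have h0 : (0 : ℝ) < 2 * ((m : ℝ) + 2) := by positivity
  rw [abs_lt]
  constructor
  · refine lt_of_lt_of_le (lt_of_mul_lt_mul_left ?_ h0.le) hδ.1
    rw [h1]; nlinarith
  · refine lt_of_le_of_lt hδ.2 (lt_of_mul_lt_mul_left ?_ h0.le)
    rw [h2]; nlinarith

theorem borderValue_shiftMax (hz : 0 ≤ z) (hzm : z ≤ m + 1) :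
    borderValue m z (shiftMax m z) = 1 := by
  have h : pathAngle m z (shiftMax m z) = 2 * shiftMax m z := by
    have h0 : (0 : ℝ) < (m : ℝ) + 1 := by positivity
    refine mul_left_cancel₀ h0.ne' ?_
    rw [mul_pathAngle]; linarith [mul_shiftMax m z]
  have hb := abs_lt.1 (abs_lt_of_mem_shift hz hzm ⟨shiftMin_le_shiftMax m z, le_rfl⟩)
  have hc : Real.cos (shiftMax m z) ≠ 0 :=
    (Real.cos_pos_of_mem_Ioo ⟨by linarith, hb.2⟩).ne'
  rw [borderValue, h, Real.cos_two_mul, Real.sin_two_mul, Real.tan_eq_sin_div_cos]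
  field_simp
  linear_combination 2 * Real.sin_sq_add_cos_sq (shiftMax m z)

theorem borderValue_shiftMin (hz : 0 ≤ z) (hzm : z ≤ m + 1) :
    borderValue m z (shiftMin m z) = -1 := by
  have h : pathAngle m z (shiftMin m z) = 2 * shiftMin m z + Real.pi := by
    have h0 : (0 : ℝ) < (m : ℝ) + 1 := by positivity
    refine mul_left_cancel₀ h0.ne' ?_
    rw [mul_pathAngle]; linarith [mul_shiftMin m z]
  have hb := abs_lt.1 (abs_lt_of_mem_shift hz hzm ⟨le_rfl, shiftMin_le_shiftMax m z⟩)
  have hc : Real.cos (shiftMin m z) ≠ 0 :=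
    (Real.cos_pos_of_mem_Ioo ⟨by linarith, hb.2⟩).ne'
  rw [borderValue, h, Real.cos_add_pi, Real.sin_add_pi, Real.cos_two_mul, Real.sin_two_mul,
    Real.tan_eq_sin_div_cos]
  field_simp
  linear_combination (-2) * Real.sin_sq_add_cos_sq (shiftMin m z)

theorem hasDerivAt_borderValue (m : ℕ) (z : ℝ) (hc : Real.cos δ ≠ 0) :
    HasDerivAt (borderValue m z)
      (Real.sin (pathAngle m z δ) / Real.cos δ ^ 2 +
        2 / ((m : ℝ) + 1) * Real.sin (pathAngle m z δ - δ) / Real.cos δ) δ := by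
  have h1 : HasDerivAt (pathAngle m z) (1 / ((m : ℝ) + 1) * (0 - 2 * 1)) δ :=
    ((((hasDerivAt_id δ).const_mul 2).const_sub (z * Real.pi)).const_mul _).congr_deriv
      (by simp)
  refine (h1.cos.add ((Real.hasDerivAt_tan hc).mul h1.sin)).congr_deriv ?_
  rw [Real.sin_sub, Real.tan_eq_sin_div_cos]
  field_simp
  ring

/-- On the shift interval the angle stays in `[0, π]` and within `[2 δ, π + 2 δ]`, which makes both
terms of the derivative positive. -/
theorem strictMonoOn_borderValue (hz : 0 ≤ z) (hzm : z ≤ m + 1) :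
    StrictMonoOn (borderValue m z) (Set.Icc (shiftMin m z) (shiftMax m z)) := by
  have hcos : ∀ δ ∈ Set.Icc (shiftMin m z) (shiftMax m z), 0 < Real.cos δ := fun δ hδ => by
    have := abs_lt.1 (abs_lt_of_mem_shift hz hzm hδ)
    exact Real.cos_pos_of_mem_Ioo ⟨by linarith, this.2⟩
  refine strictMonoOn_of_deriv_pos (convex_Icc _ _)
    (fun δ hδ => (hasDerivAt_borderValue m z (hcos δ hδ).ne').continuousAt.continuousWithinAt) ?_
  intro δ hδ
  rw [interior_Icc] at hδ
  have hc := hcos δ ⟨hδ.1.le, hδ.2.le⟩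
  rw [(hasDerivAt_borderValue m z hc.ne').deriv]
  have hp := Real.pi_pos
  have h0 : (0 : ℝ) < (m : ℝ) + 1 := by positivity
  have hm0 : (0 : ℝ) ≤ (m : ℝ) := by positivity
  have h2 : (0 : ℝ) < 2 * ((m : ℝ) + 2) := by positivity
  have hθ := mul_pathAngle m z δ
  have hlo : -((m + 1 - z) * Real.pi) < 2 * ((m : ℝ) + 2) * δ := by
    rw [← mul_shiftMin]; exact mul_lt_mul_of_pos_left hδ.1 h2
  have hhi : 2 * ((m : ℝ) + 2) * δ < z * Real.pi := by
    rw [← mul_shiftMax]; exact mul_lt_mul_of_pos_left hδ.2 h2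
  set θ := pathAngle m z δ
  have a1 : 2 * δ < θ := lt_of_mul_lt_mul_left (by linarith) h0.le
  have a2 : θ < Real.pi + 2 * δ := lt_of_mul_lt_mul_left (by linarith) h0.le
  have a3 : 0 < θ := by
    refine lt_of_mul_lt_mul_left ?_ h0.le
    rw [mul_zero, hθ]
    rcases le_or_gt δ 0 with h | h
    · rcases h.lt_or_eq with h | rfl
      · nlinarith
      · linarith
    · nlinarith
  have a4 : θ < Real.pi := by
    refine lt_of_mul_lt_mul_left ?_ h0.le
    rw [hθ]
    rcases le_or_gt 0 δ with h | h
    · rcases h.lt_or_eq with h | rfl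
      · nlinarith
      · linarith
    · nlinarith
  have s1 : 0 < Real.sin θ := Real.sin_pos_of_pos_of_lt_pi a3 a4
  have s2 : 0 < Real.sin (θ - δ) := Real.sin_pos_of_pos_of_lt_pi (by linarith) (by linarith)
  positivity

/-- For `μ ∈ [-1, 1]` the border equation has a solution that depends continuously on `μ`. -/
theorem exists_continuous_shift (hz : 0 ≤ z) (hzm : z ≤ m + 1) :
    ∃ s : Set.Icc (-1 : ℝ) 1 → ℝ, Continuous s ∧
      ∀ μ, |s μ| < Real.pi / 2 ∧ borderValue m z (s μ) = μ := by
  have hcont : ContinuousOn (borderValue m z) (Set.Icc (shiftMin m z) (shiftMax m z)) :=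
    fun δ hδ => by
      have := abs_lt.1 (abs_lt_of_mem_shift hz hzm hδ)
      exact (hasDerivAt_borderValue m z (Real.cos_pos_of_mem_Ioo
        ⟨by linarith, this.2⟩).ne').continuousAt.continuousWithinAt
  have hsurj := intermediate_value_Icc (shiftMin_le_shiftMax m z) hcont
  rw [borderValue_shiftMin hz hzm, borderValue_shiftMax hz hzm] at hsurj
  choose g hg hgμ using fun μ : Set.Icc (-1 : ℝ) 1 => hsurj μ.2
  have hemb := (continuousOn_iff_continuous_domRestrict.1 hcont).isClosedEmbedding
    (Set.injOn_iff_injective.1 (strictMonoOn_borderValue hz hzm).injOn)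
  refine ⟨g, ?_, fun μ => ⟨abs_lt_of_mem_shift hz hzm (hg μ), hgμ μ⟩⟩
  -- the inverse of a continuous injection on a compact interval is continuous
  have : Continuous fun μ => (⟨g μ, hg μ⟩ : Set.Icc (shiftMin m z) (shiftMax m z)) := by
    rw [hemb.isInducing.continuous_iff]
    refine continuous_subtype_val.congr fun μ => ?_
    simp [hgμ]
  exact continuous_subtype_val.comp this

end

/-- The averaged equation follows by the intermediate value theorem, since
`μ ↦ d μ - ∑ cos θ_j(μ)` changes sign on `[-1, 1]`. -/
theorem exists_common_shift {d : ℕ} (m : Fin d → ℕ) (z : Fin d → ℝ) (hz : ∀ j, 0 ≤ z j)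
    (hzm : ∀ j, z j ≤ m j + 1) :
    ∃ (μ : ℝ) (δ : Fin d → ℝ), (∀ j, |δ j| < Real.pi / 2) ∧
      (∀ j, borderValue (m j) (z j) (δ j) = μ) ∧
      d * μ = ∑ j, Real.cos (pathAngle (m j) (z j) (δ j)) := by
  choose s hs hsμ using fun j => exists_continuous_shift (hz j) (hzm j)
  have hc : Continuous fun μ : Set.Icc (-1 : ℝ) 1 =>
      d * (μ : ℝ) - ∑ j, Real.cos (pathAngle (m j) (z j) (s j μ)) := by
    unfold pathAngle
    fun_prop
  let l : Set.Icc (-1 : ℝ) 1 := ⟨-1, by norm_num⟩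
  let r : Set.Icc (-1 : ℝ) 1 := ⟨1, by norm_num⟩
  have hl : d * (l : ℝ) - ∑ j, Real.cos (pathAngle (m j) (z j) (s j l)) ≤ 0 := by
    have := sum_le_sum fun (j : Fin d) (_ : j ∈ univ) =>
      Real.neg_one_le_cos (pathAngle (m j) (z j) (s j l))
    simp only [sum_const, card_univ, Fintype.card_fin, nsmul_eq_mul] at this
    linarith
  have hr : 0 ≤ d * (r : ℝ) - ∑ j, Real.cos (pathAngle (m j) (z j) (s j r)) := by
    have := sum_le_sum fun (j : Fin d) (_ : j ∈ univ) =>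
      Real.cos_le_one (pathAngle (m j) (z j) (s j r))
    simp only [sum_const, card_univ, Fintype.card_fin, nsmul_eq_mul] at this
    linarith
  have : PreconnectedSpace (Set.Icc (-1 : ℝ) 1) :=
    Subtype.preconnectedSpace isPreconnected_Icc
  obtain ⟨μ, hμ⟩ := mem_range_of_exists_le_of_exists_ge hc ⟨l, hl⟩ ⟨r, hr⟩
  exact ⟨μ, fun j => s j μ, fun j => (hsμ j μ).1, fun j => (hsμ j μ).2, sub_eq_zero.1 hμ⟩

/-! ### Linear algebra of eigenvector families -/

/-- Eigenvectors are independent if those with equal eigenvalues are separated by functionals. -/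
theorem linearIndependent_of_eigenvectors {ι V : Type*} [Fintype ι] [AddCommGroup V] [Module ℝ V]
    (f : Module.End ℝ V) (lam : ι → ℝ) (v : ι → V) (B : ι → V →ₗ[ℝ] ℝ)
    (hv : ∀ z, f (v z) = lam z • v z)
    (horth : ∀ z z', lam z' = lam z → z' ≠ z → B z (v z') = 0)
    (hne : ∀ z, B z (v z) ≠ 0) : LinearIndependent ℝ v := by
  classical
  rw [Fintype.linearIndependent_iff]
  intro a ha z
  have key := (iSupIndep_iff_finsetSum_eq_zero_imp_eq_zero _).1 f.eigenspaces_iSupIndep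
    (univ.image lam) (fun μ => ∑ w with lam w = μ, a w • v w)
    (fun μ _ => Submodule.sum_mem _ fun w hw => Submodule.smul_mem _ _ <| by
      rw [Module.End.mem_eigenspace_iff, hv, (mem_filter.1 hw).2])
    ((sum_fiberwise_of_maps_to (fun w _ => mem_image_of_mem lam (mem_univ w)) _).trans ha)
    (lam z) (mem_image_of_mem lam (mem_univ z))
  have h := congrArg (B z) key
  rw [map_sum, map_zero, sum_eq_single z] at h
  · rw [map_smul, smul_eq_mul] at h
    exact (mul_eq_zero.1 h).resolve_right (hne z)
  · intro w hw hwz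
    rw [map_smul, horth z w (mem_filter.1 hw).2 hwz, smul_zero]
  · intro h'
    exact absurd h' (by simp)

theorem charpoly_eq_prod_of_eigenbasis {N : Type*} [Fintype N] [DecidableEq N]
    (M : Matrix N N ℝ) (lam : N → ℝ) (v : N → N → ℝ) (hli : LinearIndependent ℝ v)
    (hv : ∀ z, M *ᵥ v z = lam z • v z) :
    M.charpoly = ∏ z, (Polynomial.X - Polynomial.C (lam z)) := by
  have hu : IsUnit (Matrix.of v)ᵀ := by
    rw [← Matrix.linearIndependent_cols_iff_isUnit]
    exact hli
  obtain ⟨P, hP⟩ := hu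
  have h : M * P.val = P.val * Matrix.diagonal lam := by
    ext x z
    rw [Matrix.mul_diagonal, hP]
    simpa [Matrix.mul_apply, Matrix.mulVec, dotProduct, mul_comm] using congrFun (hv z) x
  rw [← Matrix.charpoly_diagonal, ← Matrix.charpoly_units_conj' P M, mul_assoc, h, ← mul_assoc,
    ← Matrix.coe_units_inv, Units.inv_mul, one_mul]

/-! ### Neighbour sums on the grid -/

section
variable {d : ℕ} {n : Fin d → ℕ}

theorem sum_gridGraph_neighborFinset (x : GridNode n) (f : GridNode n → ℝ) :
    ∑ y ∈ (gridGraph n).neighborFinset x, f y =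
      ∑ j, ∑ k ∈ pathNbrs (x j), f (Function.update x j k) := by
  rw [sum_sigma']
  symm
  have hne : ∀ {j : Fin d} {k : Fin (n j)}, k ∈ pathNbrs (x j) → k ≠ x j := fun h =>
    (mem_pathNbrs.1 h).ne'
  refine sum_nbij (fun p : (j : Fin d) × Fin (n j) => Function.update x p.1 p.2) ?_ ?_ ?_ ?_
  · rintro ⟨j, k⟩ h
    rw [mem_sigma] at h
    rw [SimpleGraph.mem_neighborFinset]
    refine ⟨j, ?_, fun i hi => ?_⟩
    · simpa using mem_pathNbrs.1 h.2
    · simp [Function.update_of_ne hi]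
  · rintro ⟨j, k⟩ h ⟨j', k'⟩ h' e
    simp only [coe_sigma, Set.mem_sigma_iff, mem_coe] at h h'
    simp only at e
    have ej := congrFun e j
    rw [Function.update_self] at ej
    by_cases hj : j = j'
    · subst hj
      rw [Function.update_self] at ej
      rw [ej]
    · rw [Function.update_of_ne hj] at ej
      exact absurd ej (hne h.2)
  · intro y hy
    rw [mem_coe, SimpleGraph.mem_neighborFinset] at hy
    obtain ⟨j, hj, h⟩ := hy
    refine ⟨⟨j, y j⟩, ?_, ?_⟩
    · simpa using mem_pathNbrs.2 hj
    · funext i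
      by_cases hi : i = j
      · subst hi; simp
      · simp [Function.update_of_ne hi, h i hi]
  · intros; rfl

theorem degree_gridGraph (x : GridNode n) :
    ((gridGraph n).degree x : ℝ) = ∑ j, ((pathNbrs (x j)).card : ℝ) := by
  simpa [SimpleGraph.card_neighborFinset_eq_degree] using
    sum_gridGraph_neighborFinset x (fun _ => 1)

/-- A product of solutions of the perturbed path equations solves the grid equation, provided that
the path eigenvalues average to `-2 μ`: the degree deficits of the dimensions add up. -/
theorem sum_neighborFinset_prod {φ : Fin d → ℕ → ℝ} {c : Fin d → ℝ} {μ : ℝ}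
    (hφ : ∀ j (i : Fin (n j)), ∑ k ∈ pathNbrs i, φ j k =
      (-2 * c j + μ * (2 - ((pathNbrs i).card : ℝ))) * φ j i)
    (hc : d * μ = ∑ j, c j) (x : GridNode n) :
    ∑ y ∈ (gridGraph n).neighborFinset x, ∏ j, φ j (y j) =
      -μ * (gridGraph n).degree x * ∏ j, φ j (x j) := by
  have h : ∀ j, ∑ k ∈ pathNbrs (x j), ∏ i, φ i (Function.update x j k i) =
      (-2 * c j + μ * (2 - ((pathNbrs (x j)).card : ℝ))) * ∏ i, φ i (x i) := by
    intro j
    have h1 : ∀ k, ∏ i, φ i (Function.update x j k i) =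
        φ j k * ∏ i ∈ univ.erase j, φ i (x i) := by
      intro k
      rw [← mul_prod_erase univ _ (mem_univ j), Function.update_self]
      congr 1
      refine prod_congr rfl fun i hi => ?_
      rw [Function.update_of_ne (ne_of_mem_erase hi)]
    rw [sum_congr rfl fun k _ => h1 k, ← sum_mul, hφ, mul_assoc,
      mul_prod_erase univ (fun i => φ i (x i)) (mem_univ j)]
  rw [sum_gridGraph_neighborFinset, sum_congr rfl fun j _ => h j, ← sum_mul, degree_gridGraph]
  congr 1
  rw [sum_add_distrib, ← mul_sum, ← mul_sum, sum_sub_distrib, ← hc]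
  simp
  ring

theorem two_le_of_isInnerNode {x : GridNode n} (hx : IsInnerNode x) (j : Fin d) : 2 ≤ n j := by
  obtain ⟨y, y', -, hy, -, h⟩ := hx j
  have hne : x j ≠ y j := by
    intro e
    refine hy.ne (funext fun i => ?_)
    by_cases hi : i = j
    · rw [hi, e]
    · exact (h i hi).1
  have h1 := (x j).2
  have h2 := (y j).2
  have h3 := Fin.val_ne_of_ne hne
  omega

/-! ### The two Laplacians -/

theorem gridDSqrt_mul_self (n : Fin d → ℕ) : gridDSqrt n * gridDSqrt n = gridD n := by
  rw [gridDSqrt, Matrix.diagonal_mul_diagonal]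
  simp [SimpleGraph.degMatrix]

theorem isUnit_gridDSqrt (hdeg : ∀ x : GridNode n, 0 < (gridGraph n).degree x) :
    IsUnit (gridDSqrt n) := by
  rw [gridDSqrt, Matrix.isUnit_diagonal, Pi.isUnit_iff]
  exact fun x => isUnit_iff_ne_zero.2 (Real.sqrt_pos.2 (by exact_mod_cast hdeg x)).ne'

theorem gridRandomWalkLaplacian_eq_conj (hdeg : ∀ x : GridNode n, 0 < (gridGraph n).degree x) :
    gridRandomWalkLaplacian n = gridDSqrt n * gridNormalizedLaplacian n * (gridDSqrt n)⁻¹ := by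
  have hu := (Matrix.isUnit_iff_isUnit_det _).1 (isUnit_gridDSqrt hdeg)
  rw [gridRandomWalkLaplacian, gridNormalizedLaplacian, ← gridDSqrt_mul_self, Matrix.mul_inv_rev]
  simp only [← mul_assoc]
  rw [Matrix.mul_nonsing_inv _ hu, one_mul]

theorem charpoly_gridNormalizedLaplacian (hdeg : ∀ x : GridNode n, 0 < (gridGraph n).degree x) :
    (gridNormalizedLaplacian n).charpoly = (gridRandomWalkLaplacian n).charpoly := by
  obtain ⟨P, hP⟩ := isUnit_gridDSqrt hdeg
  rw [gridRandomWalkLaplacian_eq_conj hdeg, ← hP, Matrix.charpoly_units_conj]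

theorem lapMatrix_mulVec_of_sum {μ : ℝ} {g : GridNode n → ℝ}
    (hg : ∀ x, ∑ y ∈ (gridGraph n).neighborFinset x, g y =
      -μ * (gridGraph n).degree x * g x) :
    gridL n *ᵥ g = (1 + μ) • (gridD n *ᵥ g) := by
  ext x
  rw [gridL, SimpleGraph.lapMatrix, Matrix.sub_mulVec, Pi.sub_apply, Pi.smul_apply,
    SimpleGraph.degMatrix_mulVec_apply, SimpleGraph.adjMatrix_mulVec_apply, hg, smul_eq_mul]
  ring

theorem randomWalkVec_eq (z : Fin d → ℤ) (δ : Fin d → ℝ) :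
    randomWalkVec n z δ = gridD n *ᵥ gridProduct n z δ := by
  ext x
  simp [randomWalkVec, SimpleGraph.degMatrix, Matrix.mulVec_diagonal]

theorem normalizedVec_eq (z : Fin d → ℤ) (δ : Fin d → ℝ) :
    normalizedVec n z δ = gridDSqrt n *ᵥ gridProduct n z δ := by
  ext x
  simp [normalizedVec, gridDSqrt, Matrix.mulVec_diagonal]

theorem randomWalkVec_eq_gridDSqrt_mulVec (z : Fin d → ℤ) (δ : Fin d → ℝ) :
    randomWalkVec n z δ = gridDSqrt n *ᵥ normalizedVec n z δ := by
  rw [randomWalkVec_eq, normalizedVec_eq, Matrix.mulVec_mulVec, gridDSqrt_mul_self]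

theorem gridNormalizedLaplacian_mulVec (hdeg : ∀ x : GridNode n, 0 < (gridGraph n).degree x)
    {a : ℝ} {g : GridNode n → ℝ} (hg : gridL n *ᵥ g = a • (gridD n *ᵥ g)) :
    gridNormalizedLaplacian n *ᵥ (gridDSqrt n *ᵥ g) = a • (gridDSqrt n *ᵥ g) := by
  have hu := (Matrix.isUnit_iff_isUnit_det _).1 (isUnit_gridDSqrt hdeg)
  rw [gridNormalizedLaplacian, Matrix.mulVec_mulVec, mul_assoc, Matrix.nonsing_inv_mul _ hu,
    mul_one, ← Matrix.mulVec_mulVec, hg, Matrix.mulVec_smul, Matrix.mulVec_mulVec,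
    ← gridDSqrt_mul_self, ← mul_assoc, Matrix.nonsing_inv_mul _ hu, one_mul]

theorem gridRandomWalkLaplacian_mulVec (hdeg : ∀ x : GridNode n, 0 < (gridGraph n).degree x)
    {a : ℝ} {g : GridNode n → ℝ} (hg : gridL n *ᵥ g = a • (gridD n *ᵥ g)) :
    gridRandomWalkLaplacian n *ᵥ (gridD n *ᵥ g) = a • (gridD n *ᵥ g) := by
  have hu : IsUnit (gridD n).det := by
    rw [← Matrix.isUnit_iff_isUnit_det, ← gridDSqrt_mul_self]
    exact (isUnit_gridDSqrt hdeg).mul (isUnit_gridDSqrt hdeg)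
  rw [gridRandomWalkLaplacian, Matrix.mulVec_mulVec, mul_assoc, Matrix.nonsing_inv_mul _ hu,
    mul_one, hg]

end

/-! ### Product waves on the grid -/

section
variable {d : ℕ} {m : Fin d → ℕ}

theorem gridAngle_eq_pathAngle (m : Fin d → ℕ) (z : Fin d → ℤ) (δ : Fin d → ℝ) (j : Fin d) :
    gridAngle (fun j => m j + 2) z δ j = pathAngle (m j) (z j) (δ j) := by
  rw [gridAngle, pathAngle]
  congr 2
  push_cast
  ring

theorem mul_gridAngle (m : Fin d → ℕ) (z : Fin d → ℤ) (δ : Fin d → ℝ) (j : Fin d) :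
    ((m j : ℝ) + 1) * gridAngle (fun j => m j + 2) z δ j = z j * Real.pi - 2 * δ j := by
  rw [gridAngle_eq_pathAngle, mul_pathAngle]

theorem gridProduct_eq {n : Fin d → ℕ} (z : Fin d → ℤ) (δ : Fin d → ℝ) (x : GridNode n) :
    gridProduct n z δ x = ∏ j, pathMode (gridAngle n z δ j) (δ j) (x j) := by
  refine prod_congr rfl fun j _ => ?_
  rw [pathMode, gridAngle, gridCoord]
  congr 3
  push_cast
  ring

theorem degree_pos (hd : 0 < d) (x : GridNode fun j => m j + 2) :
    0 < (gridGraph fun j => m j + 2).degree x := by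
  have : (0 : ℝ) < ((gridGraph fun j => m j + 2).degree x : ℝ) := by
    rw [degree_gridGraph]
    refine sum_pos (fun j _ => ?_) ⟨⟨0, hd⟩, mem_univ _⟩
    have h := (x j).2
    rw [card_pathNbrs]
    split_ifs
    · norm_num
    · norm_num
    · norm_num
    · omega
  exact_mod_cast this

variable {n : Fin d → ℕ} {z : Fin d → ℤ} {lam : ℝ} {δ : Fin d → ℝ}

theorem IsShiftSolution.mul_eq_sum_cos (h : IsShiftSolution n z lam δ) :
    d * (lam - 1) = ∑ j, Real.cos (gridAngle n z δ j) := by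
  have := h.inner_eq
  rw [sum_add_distrib, ← mul_sum] at this
  simp at this
  linarith

theorem IsShiftSolution.eq_average (h : IsShiftSolution n z lam δ) (hd : 0 < d) :
    lam = 1 + 1 / (d : ℝ) * ∑ j, Real.cos (gridAngle n z δ j) := by
  have hd' : (d : ℝ) ≠ 0 := by exact_mod_cast hd.ne'
  rw [← h.mul_eq_sum_cos]
  field_simp
  ring

theorem IsShiftSolution.mul_cos_eq (h : IsShiftSolution n z lam δ) (j : Fin d) :
    (lam - 1) * Real.cos (δ j) = Real.cos (gridAngle n z δ j - δ j) := by
  have hc := h.tan_defined j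
  have := h.border_eq j
  rw [Real.tan_eq_sin_div_cos] at this
  rw [this, Real.cos_sub]
  field_simp
  ring

theorem IsShiftSolution.lap_mulVec (h : IsShiftSolution (fun j => m j + 2) z lam δ) :
    gridL (fun j => m j + 2) *ᵥ gridProduct _ z δ =
      lam • (gridD (fun j => m j + 2) *ᵥ gridProduct _ z δ) := by
  have := lapMatrix_mulVec_of_sum (μ := lam - 1) (g := gridProduct (fun j => m j + 2) z δ)
    (fun x => by
      simp only [gridProduct_eq]
      exact sum_neighborFinset_prod (fun j i =>
        sum_pathNbrs_pathMode (mul_gridAngle m z δ j) (h.mul_cos_eq j) i) h.mul_eq_sum_cos x)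
  rwa [add_sub_cancel] at this

/-- At the corner all of whose coordinates are one, the product is `± ∏ cos δ_j`. -/
theorem IsShiftSolution.gridProduct_ne_zero (h : IsShiftSolution (fun j => m j + 2) z lam δ) :
    gridProduct (fun j => m j + 2) z δ (fun _ => 0) ≠ 0 := by
  rw [gridProduct_eq, prod_ne_zero_iff]
  intro j _
  simpa [pathMode] using h.tan_defined j

theorem mulVec_gridProduct_ne_zero (h : IsShiftSolution (fun j => m j + 2) z lam δ)
    {M : Matrix (GridNode fun j => m j + 2) (GridNode fun j => m j + 2) ℝ} (hM : IsUnit M) :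
    M *ᵥ gridProduct _ z δ ≠ 0 := by
  intro h0
  have := Matrix.mulVec_injective_of_isUnit hM (h0.trans (Matrix.mulVec_zero M).symm)
  exact h.gridProduct_ne_zero (congrFun this _)

theorem hasEigenvector_randomWalkVec (hd : 0 < d)
    (h : IsShiftSolution (fun j => m j + 2) z lam δ) :
    Module.End.HasEigenvector (Matrix.toLin' (gridRandomWalkLaplacian fun j => m j + 2)) lam
      (randomWalkVec _ z δ) := by
  rw [Module.End.hasEigenvector_iff, Module.End.mem_eigenspace_iff, Matrix.toLin'_apply,
    randomWalkVec_eq]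
  refine ⟨gridRandomWalkLaplacian_mulVec (degree_pos hd) h.lap_mulVec,
    mulVec_gridProduct_ne_zero h ?_⟩
  rw [← gridDSqrt_mul_self]
  exact (isUnit_gridDSqrt (degree_pos hd)).mul (isUnit_gridDSqrt (degree_pos hd))

theorem hasEigenvector_normalizedVec (hd : 0 < d)
    (h : IsShiftSolution (fun j => m j + 2) z lam δ) :
    Module.End.HasEigenvector (Matrix.toLin' (gridNormalizedLaplacian fun j => m j + 2)) lam
      (normalizedVec _ z δ) := by
  rw [Module.End.hasEigenvector_iff, Module.End.mem_eigenspace_iff, Matrix.toLin'_apply,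
    normalizedVec_eq]
  exact ⟨gridNormalizedLaplacian_mulVec (degree_pos hd) h.lap_mulVec,
    mulVec_gridProduct_ne_zero h (isUnit_gridDSqrt (degree_pos hd))⟩

theorem exists_isShiftSolution (z : GridNode fun j => m j + 2) :
    ∃ (lam : ℝ) (δ : Fin d → ℝ), IsShiftSolution (fun j => m j + 2) (gridIndex z) lam δ ∧
      ∀ j, |δ j| < Real.pi / 2 := by
  obtain ⟨μ, δ, hδ, hb, hs⟩ := exists_common_shift m (fun j => ((gridIndex z j : ℤ) : ℝ))
    (fun j => by simp [gridIndex])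
    (fun j => by
      have : (z j : ℕ) ≤ m j + 1 := Nat.lt_succ_iff.1 (z j).2
      simpa [gridIndex] using (by exact_mod_cast this : ((z j : ℕ) : ℝ) ≤ m j + 1))
  simp only [← gridAngle_eq_pathAngle] at hs
  refine ⟨1 + μ, δ, ⟨?_, fun l => ?_, fun l => ?_⟩, hδ⟩
  · rw [sum_add_distrib, ← mul_sum, ← hs]
    simp
    ring
  · exact (Real.cos_pos_of_mem_Ioo ⟨by linarith [abs_lt.1 (hδ l)], (abs_lt.1 (hδ l)).2⟩).ne'
  · rw [gridAngle_eq_pathAngle, ← hb l, borderValue]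
    ring

theorem sum_gridProduct_mul (z z' : Fin d → ℤ) (δ δ' : Fin d → ℝ) :
    ∑ x : GridNode n, gridProduct n z δ x * gridProduct n z' δ' x =
      ∏ j, ∑ i : Fin (n j), pathMode (gridAngle n z δ j) (δ j) i *
        pathMode (gridAngle n z' δ' j) (δ' j) i := by
  rw [prod_univ_sum, Fintype.piFinset_univ]
  refine sum_congr rfl fun x _ => ?_
  rw [gridProduct_eq, gridProduct_eq, prod_mul_distrib]

/-- Product waves with the same eigenvalue are orthogonal already in a dimension where their
indices differ. -/
theorem sum_gridProduct_mul_eq_zero {z z' : GridNode fun j => m j + 2} {δ' : Fin d → ℝ}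
    (h : IsShiftSolution (fun j => m j + 2) (gridIndex z) lam δ) (hδ : ∀ j, |δ j| < Real.pi / 2)
    (h' : IsShiftSolution (fun j => m j + 2) (gridIndex z') lam δ')
    (hδ' : ∀ j, |δ' j| < Real.pi / 2) (hne : z ≠ z') :
    ∑ x, gridProduct (fun j => m j + 2) (gridIndex z) δ x * gridProduct _ (gridIndex z') δ' x =
      0 := by
  obtain ⟨j, hj⟩ := Function.ne_iff.1 hne
  have hj := Fin.val_ne_of_ne hj
  have h1 : (z j : ℕ) < m j + 2 := (z j).2
  have h2 : (z' j : ℕ) < m j + 2 := (z' j).2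
  rw [sum_gridProduct_mul]
  refine prod_eq_zero (mem_univ j) ?_
  refine sum_pathMode_mul_eq_zero (mul_gridAngle m _ δ j) (mul_gridAngle m _ δ' j)
    (h.mul_cos_eq j) (h'.mul_cos_eq j) ?_
  refine cos_ne_cos_of_index_ne (μ := lam - 1) (mul_gridAngle m _ δ j) (mul_gridAngle m _ δ' j)
    (hδ j) (hδ' j) (by linarith [h.border_eq j]) (by linarith [h'.border_eq j]) ?_ ?_ ?_ ?_ ?_ <;>
  · simp only [gridIndex]
    omega

theorem linearIndependent_randomWalkVec (hd : 0 < d) {lam : (GridNode fun j => m j + 2) → ℝ}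
    {δ : (GridNode fun j => m j + 2) → Fin d → ℝ}
    (h : ∀ z, IsShiftSolution (fun j => m j + 2) (gridIndex z) (lam z) (δ z) ∧
      ∀ j, |δ z j| < Real.pi / 2) :
    LinearIndependent ℝ fun z => randomWalkVec (fun j => m j + 2) (gridIndex z) (δ z) := by
  -- pairing with `D⁻¹` times a vector turns the degree-weighted vectors into plain products
  let B : (GridNode fun j => m j + 2) → ((GridNode fun j => m j + 2) → ℝ) →ₗ[ℝ] ℝ := fun z =>
    dotProductBilin ℝ ℝ fun x =>
      gridProduct (fun j => m j + 2) (gridIndex z) (δ z) x / (gridGraph fun j => m j + 2).degree x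
  have hB : ∀ z z', B z (randomWalkVec _ (gridIndex z') (δ z')) =
      ∑ x, gridProduct (fun j => m j + 2) (gridIndex z) (δ z) x *
        gridProduct _ (gridIndex z') (δ z') x := by
    intro z z'
    refine sum_congr rfl fun x _ => ?_
    have : ((gridGraph fun j => m j + 2).degree x : ℝ) ≠ 0 := by
      exact_mod_cast (degree_pos hd x).ne'
    simp only [randomWalkVec, SimpleGraph.degMatrix, Matrix.diagonal_apply_eq]
    field_simp
  refine linearIndependent_of_eigenvectors
    (Matrix.toLin' (gridRandomWalkLaplacian fun j => m j + 2)) lam _ B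
    (fun z => (hasEigenvector_randomWalkVec hd (h z).1).apply_eq_smul) ?_ ?_
  · intro z z' hl hne
    rw [hB]
    exact sum_gridProduct_mul_eq_zero (h z).1 (h z).2 (hl ▸ (h z').1) (h z').2 hne.symm
  · intro z
    rw [hB]
    exact (sum_pos' (fun x _ => mul_self_nonneg _)
      ⟨_, mem_univ _, mul_self_pos.2 (h z).1.gridProduct_ne_zero⟩).ne'

end

theorem mainTheorem6 (d : ℕ) (hd : 0 < d) (n : Fin d → ℕ)
    (hinner : ∃ x : GridNode n, IsInnerNode x) :
    -- every solution of the system yields eigenpairs of both Laplacians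
    (∀ (z : Fin d → ℤ) (lam : ℝ) (δ : Fin d → ℝ), IsShiftSolution n z lam δ →
      lam = 1 + 1 / (d : ℝ) *
        ∑ j, Real.cos (1 / ((n j : ℝ) - 1) * ((z j : ℝ) * Real.pi - 2 * δ j)) ∧
      Module.End.HasEigenvector (Matrix.toLin' (gridRandomWalkLaplacian n)) lam
        (randomWalkVec n z δ) ∧
      Module.End.HasEigenvector (Matrix.toLin' (gridNormalizedLaplacian n)) lam
        (normalizedVec n z δ) ∧
      randomWalkVec n z δ = gridDSqrt n *ᵥ normalizedVec n z δ) ∧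
    -- for every index vector the system has a solution with shifts in `(-π/2, π/2)`
    (∀ z : GridNode n, ∃ (lam : ℝ) (δ : Fin d → ℝ),
      IsShiftSolution n (gridIndex z) lam δ ∧ ∀ j, |δ j| < Real.pi / 2) ∧
    -- such solutions give all eigenvalues with multiplicity, and a basis of eigenvectors
    (∀ (lam : GridNode n → ℝ) (δ : GridNode n → Fin d → ℝ),
      (∀ z, IsShiftSolution n (gridIndex z) (lam z) (δ z) ∧ ∀ j, |δ z j| < Real.pi / 2) →
      (gridRandomWalkLaplacian n).charpoly = ∏ z, (Polynomial.X - Polynomial.C (lam z)) ∧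
      (gridNormalizedLaplacian n).charpoly = ∏ z, (Polynomial.X - Polynomial.C (lam z)) ∧
      (∀ μ : ℝ, Module.End.HasEigenvalue (Matrix.toLin' (gridRandomWalkLaplacian n)) μ ↔
        ∃ z, μ = lam z) ∧
      LinearIndependent ℝ (fun z => randomWalkVec n (gridIndex z) (δ z)) ∧
      Submodule.span ℝ (Set.range fun z => randomWalkVec n (gridIndex z) (δ z)) = ⊤) := by
  obtain ⟨x, hx⟩ := hinner
  obtain ⟨m, rfl⟩ : ∃ m : Fin d → ℕ, n = fun j => m j + 2 :=
    ⟨fun j => n j - 2, funext fun j => (Nat.sub_add_cancel (two_le_of_isInnerNode hx j)).symm⟩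
  refine ⟨fun z lam δ h => ⟨h.eq_average hd, hasEigenvector_randomWalkVec hd h,
    hasEigenvector_normalizedVec hd h, randomWalkVec_eq_gridDSqrt_mulVec z δ⟩,
    exists_isShiftSolution, fun lam δ h => ?_⟩
  have hli := linearIndependent_randomWalkVec hd h
  have hchar := charpoly_eq_prod_of_eigenbasis
    (gridRandomWalkLaplacian fun j => m j + 2) lam _ hli
    (fun z => (hasEigenvector_randomWalkVec hd (h z).1).apply_eq_smul)
  refine ⟨hchar, (charpoly_gridNormalizedLaplacian (degree_pos hd)).trans hchar, fun μ => ?_, hli,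
    hli.span_eq_top_of_card_eq_finrank' (Module.finrank_fintype_fun_eq_card ℝ).symm⟩
  rw [Module.End.hasEigenvalue_iff_isRoot_charpoly, Matrix.charpoly_toLin', hchar,
    Polynomial.isRoot_prod]
  simp [sub_eq_zero]
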